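/- **Absorbing chains.** Let $M$ be a real $m\times m$ matrix and $Q$ a real $m\times 2$ matrix such that $M_{ij}\ge 0$ for $i\ne j$, all $Q_{iu}\ge 0$, $M_{ii}=-\sum_{j\ne i}M_{ij}-(Q_{i1}+Q_{i2})$ for all $i$, and from every $i\in\{1,\dots,m\}$ there is a path of positive rates $M_{ij}$ (possibly of length $0$) to some $k$ with $Q_{k1}+Q_{k2}>0$. Let $(X_t)_{t\ge 0}$ be a right-continuous continuous-time Markov chain, with arbitrary initial law, on the transient states $1,\dots,m$ and the two absorbing states "reneged" and "matched", with generator $\begin{pmatrix}M&Q\\0&0\end{pmatrix}$ (the first column of $Q$ holds the rates into "reneged", the second those into "matched"). Then $M$ is invertible, and with the fundamental matrix $N=-M^{-1}$ and any state $i\in\{1,\dots,m\}$ with $\mathbb P[X_0=i]>0$, $$\mathbb P[\text{Matched}\mid X_0=i]=(NQ)_{i2},$$ and, if this probability is positive, the match time (the first time at which the chain is in "matched") has finite conditional expectation $$\mathbb E[\text{Match Time}\mid X_0=i,\ \text{Matched}]=\frac{(N^2Q)_{i2}}{(NQ)_{i2}}.$$ **The rider chains.** Let $U\ge1$ be an integer,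 $\mu,\eta,\tilde\eta_N\ge0$, $p\in[0,1]$, and $(q_0,\dots,q_U)$ a probability vector, and assume that $\eta>0$, or that $\mu>0$, $p>0$ and $q_\ell>0$ for some $\ell\ge1$. Put $\beta=\mu(1-p)+\tilde\eta_N$. Then the following two pairs $(M,Q)$ satisfy all the assumptions above, so that the formulas hold for them. In both, $Q_{i1}=\eta$ for all $i$, rates not listed are zero, and the diagonal of $M$ is given by the conservation identity. * *First Accept* ($m=U+1$, states $R_0,\dots,R_U$ in this order): $R_0\to R_\ell$ at rate $q_\ell$ for $1\le\ell\le U$; $R_\ell\to R_{\ell-1}$ at rate $\ell\beta$ for $\ell\ge1$; $R_\ell\to$ matched at rate $\ell\mu p$. * *Best Accept* ($m=2U$, states $R_0,\dots,R_U,A_U,\dots,A_2$ in this order): $R_0\to R_\ell$ at rate $q_\ell$ for $1\le\ell\le U$; $R_\ell\to R_{\ell-1}$ at rate $\ell\beta$ for $\ell\ge1$; $R_\ell\to A_j$ at rate $\mu p$ for $2\le j\le\ell$; $R_\ell\to$ matched at rate $\mu p$ for $\ell\ge1$; $A_\ell\to A_j$ for $2\le j<\ell$ at rate $\mu p$, increased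 by $(\ell-1)\beta$ if $j=\ell-1$; $A_\ell\to$ matched at rate $\mu p$ for $\ell\ge3$, and $A_2\to$ matched at rate $\mu+\tilde\eta_N$. -/

import Mathlib

open MeasureTheory ProbabilityTheory Filter Topology
open scoped NNReal

noncomputable section

/-! ### Absorbing continuous-time Markov chains -/

/-- The rates of an absorbing continuous-time Markov chain with transient states `Fin m` and the two
absorbing states `0` (reneged) and `1` (matched): `M` holds the rates among transient states, `Q` the
rates into the absorbing states, the diagonal of `M` is fixed by conservation, and from every
transient state an absorbing state can be reached along transitions of positive rate. -/
structure IsAbsorbingRates {m : ℕ} (M : Matrix (Fin m) (Fin m) ℝ) (Q : Matrix (Fin m) (Fin 2) ℝ) :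
    Prop where
  offDiag_nonneg : ∀ i j, i ≠ j → 0 ≤ M i j
  absorb_nonneg : ∀ i u, 0 ≤ Q i u
  conservation : ∀ i, M i i = -(∑ j ∈ Finset.univ.erase i, M i j) - (Q i 0 + Q i 1)
  absorbing : ∀ i, ∃ k, Relation.ReflTransGen (fun a b => 0 < M a b) i k ∧ ∃ u, 0 < Q k u

/-- The generator of the whole chain; absorbing states have zero outgoing rates. -/
def absorbingGenerator {m : ℕ} (M : Matrix (Fin m) (Fin m) ℝ) (Q : Matrix (Fin m) (Fin 2) ℝ) :
    Matrix (Fin m ⊕ Fin 2) (Fin m ⊕ Fin 2) ℝ :=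
  Matrix.fromBlocks M Q 0 0

/-- `X` is a continuous-time Markov chain with finite state space `E` and generator `G` under `P`:
its paths are right-continuous (for the discrete topology on `E`) and its finite-dimensional
distributions are those of a Markov process with transition matrices `exp (t G)`. The initial law
is arbitrary. -/
structure IsCTMC {E Ω : Type*} [Fintype E] [DecidableEq E] [MeasurableSpace Ω]
    (G : Matrix E E ℝ) (P : Measure Ω) (X : ℝ≥0 → Ω → E) : Prop where
  measurable : ∀ t x, MeasurableSet {ω | X t ω = x}
  rightContinuous : ∀ ω t, ∀ᶠ s in 𝓝[>] t, X s ω = X t ω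
  markov : ∀ (n : ℕ) (t : Fin (n + 1) → ℝ≥0) (x : Fin (n + 1) → E), Monotone t →
    P.real {ω | ∀ k, X (t k) ω = x k} =
      P.real {ω | X (t 0) ω = x 0} *
        ∏ k : Fin n, NormedSpace.exp (((t k.succ : ℝ) - (t k.castSucc : ℝ)) • G)
          (x k.castSucc) (x k.succ)

/-- The fundamental matrix `N = -M⁻¹`. -/
def fundamentalMatrix {m : ℕ} (M : Matrix (Fin m) (Fin m) ℝ) : Matrix (Fin m) (Fin m) ℝ := -M⁻¹

/-- The event that the chain is ever absorbed in the state "matched". -/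
def matchedEvent {m : ℕ} {Ω : Type*} (X : ℝ≥0 → Ω → Fin m ⊕ Fin 2) : Set Ω :=
  {ω | ∃ t, X t ω = Sum.inr 1}

/-- The first time at which the chain is in the state "matched" (only used on `matchedEvent X`). -/
def matchTime {m : ℕ} {Ω : Type*} (X : ℝ≥0 → Ω → Fin m ⊕ Fin 2) (ω : Ω) : ℝ :=
  ((sInf {t : ℝ≥0 | X t ω = Sum.inr 1} : ℝ≥0) : ℝ)

/-! ### The rider chains under First Accept and Best Accept -/

/-- Parameters of a rider's lifecycle: at most `U` drivers are notified at a time, each responds at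
rate `μ` and then accepts with probability `p`; riders renege at rate `η`; notified drivers leave at
rate `ηN`; a waiting rider is notified to exactly `ℓ` drivers with probability `q ℓ`, the
notification rate being normalized to one. -/
structure RiderParams (U : ℕ) where
  μ : ℝ
  p : ℝ
  η : ℝ
  ηN : ℝ
  q : ℕ → ℝ
  μ_nonneg : 0 ≤ μ
  p_nonneg : 0 ≤ p
  p_le_one : p ≤ 1
  η_nonneg : 0 ≤ η
  ηN_nonneg : 0 ≤ ηN
  q_nonneg : ∀ ℓ, 0 ≤ q ℓ
  q_sum : ∑ ℓ ∈ Finset.range (U + 1), q ℓ = 1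

/-- A rider can leave the platform at all: riders renege, or else notifications are sent out with
positive probability and drivers accept at a positive rate. -/
def RiderParams.CanLeave {U : ℕ} (c : RiderParams U) : Prop :=
  0 < c.η ∨ (0 < c.μ ∧ 0 < c.p ∧ ∃ ℓ, 1 ≤ ℓ ∧ ℓ ≤ U ∧ 0 < c.q ℓ)

/-- The transient rate matrix with off-diagonal entries `r` and diagonal fixed by conservation. -/
def transientMatrix {m : ℕ} (r : Fin m → Fin m → ℝ) (Q : Matrix (Fin m) (Fin 2) ℝ) :
    Matrix (Fin m) (Fin m) ℝ :=
  Matrix.of fun i j =>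
    if i = j then -(∑ k ∈ Finset.univ.erase i, r i k) - (Q i 0 + Q i 1) else r i j

/-- Transition rate from `R_ℓ` to `R_k`, `k ≠ ℓ`, where `R_ℓ` is the state of a rider with `ℓ`
outstanding notifications. -/
def RiderParams.notifyRate {U : ℕ} (c : RiderParams U) (ℓ k : ℕ) : ℝ :=
  if ℓ = 0 then c.q k
  else if k + 1 = ℓ then (ℓ : ℝ) * (c.μ * (1 - c.p) + c.ηN) else 0

/-- First Accept: the transient states are `R_0, …, R_U`. -/
def RiderParams.faQ {U : ℕ} (c : RiderParams U) : Matrix (Fin (U + 1)) (Fin 2) ℝ :=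
  Matrix.of fun i u => if u = 0 then c.η else ((i : ℕ) : ℝ) * c.μ * c.p

def RiderParams.faM {U : ℕ} (c : RiderParams U) : Matrix (Fin (U + 1)) (Fin (U + 1)) ℝ :=
  transientMatrix (fun i j => c.notifyRate i j) c.faQ

/-- Rider states under Best Accept: `waiting ℓ` is `R_ℓ`, and `accepted ℓ` is `A_ℓ`, in which the
best acceptance so far came from the driver of rank `ℓ`, the `ℓ - 1` better ranked drivers being
still outstanding. -/
inductive RiderState
  | waiting (ℓ : ℕ)
  | accepted (ℓ : ℕ)

/-- The order of the `2U` transient states under Best Accept: `R_0, R_1, …, R_U, A_U, …, A_2`. -/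
def baState (U : ℕ) (i : Fin (2 * U)) : RiderState :=
  if (i : ℕ) ≤ U then RiderState.waiting i else RiderState.accepted (2 * U + 1 - i)

/-- Transition rates between distinct transient states under Best Accept. -/
def RiderParams.baRate {U : ℕ} (c : RiderParams U) : RiderState → RiderState → ℝ
  | .waiting ℓ, .waiting k => c.notifyRate ℓ k
  | .waiting ℓ, .accepted k => if k ≤ ℓ then c.μ * c.p else 0
  | .accepted _, .waiting _ => 0
  | .accepted ℓ, .accepted k =>
      (if k < ℓ then c.μ * c.p else 0) +
        (if k + 1 = ℓ then (k : ℝ) * (c.μ * (1 - c.p) + c.ηN) else 0)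

/-- Rates into "matched" under Best Accept: a rider is matched when the best ranked outstanding
driver accepts, and also when, in `A_2`, the only outstanding driver rejects or leaves. -/
def RiderParams.baMatchRate {U : ℕ} (c : RiderParams U) : RiderState → ℝ
  | .waiting ℓ => if ℓ = 0 then 0 else c.μ * c.p
  | .accepted ℓ => if ℓ = 2 then c.μ + c.ηN else c.μ * c.p

def RiderParams.baQ {U : ℕ} (c : RiderParams U) : Matrix (Fin (2 * U)) (Fin 2) ℝ :=
  Matrix.of fun i u => if u = 0 then c.η else c.baMatchRate (baState U i)

def RiderParams.baM {U : ℕ} (c : RiderParams U) : Matrix (Fin (2 * U)) (Fin (2 * U)) ℝ :=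
  transientMatrix (fun i j => c.baRate (baState U i) (baState U j)) c.baQ

end

/-!
A matrix `M` of transient rates satisfies a minimum principle: `M *ᵥ v ≤ 0` forces `0 ≤ v`. Hence
`M` is invertible and `N = -M⁻¹` is entrywise nonnegative, which makes the nonnegative function
`exp (t • M)` integrable on `(0, ∞)`, with limit `0` and integral `N`. The exponential of the whole
generator has the upper right block `N * Q - exp (t • M) * N * Q`, whose entry `(i, u)` is the
probability of having been absorbed in `u` by time `t`, starting from `i`. Letting `t → ∞` gives the
absorption probability `(N * Q) i u`, and integrating the tail `(exp (t • M) * N * Q) i u` over `t`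
gives `(N ^ 2 * Q) i u` for the expected absorption time on the event of absorption in `u`.
-/

open NormedSpace (exp)
open scoped Matrix

section MatrixExponential

variable {n k : Type*} [Fintype n] [DecidableEq n]

theorem hasSum_matrix_exp (A : Matrix n n ℝ) :
    HasSum (fun r : ℕ => (r.factorial : ℝ)⁻¹ • A ^ r) (exp A) := by
  let _ := Matrix.linftyOpNormedRing (n := n) (α := ℝ)
  let _ := Matrix.linftyOpNormedAlgebra (R := ℝ) (n := n) (α := ℝ)
  exact NormedSpace.exp_series_hasSum_exp' (𝕂 := ℝ) A

theorem hasDerivAt_matrix_exp_smul (A : Matrix n n ℝ) (t : ℝ) (i j : n) :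
    HasDerivAt (fun s : ℝ => exp (s • A) i j) ((exp (t • A) * A) i j) t := by
  let _ := Matrix.linftyOpNormedRing (n := n) (α := ℝ)
  let _ := Matrix.linftyOpNormedAlgebra (R := ℝ) (n := n) (α := ℝ)
  exact (Matrix.entryLinearMap ℝ ℝ i j).toContinuousLinearMap.hasFDerivAt.comp_hasDerivAt t
    (hasDerivAt_exp_smul_const (𝕂 := ℝ) A t)

theorem hasDerivAt_matrix_exp_smul_mul (A : Matrix n n ℝ) (R : Matrix n k ℝ) (t : ℝ)
    (i : n) (u : k) :
    HasDerivAt (fun s : ℝ => (exp (s • A) * R) i u) ((exp (t • A) * (A * R)) i u) t := by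
  rw [← Matrix.mul_assoc]
  exact HasDerivAt.fun_sum fun j _ => (hasDerivAt_matrix_exp_smul A t i j).mul_const (R j u)

theorem matrix_exp_mul_eq_mul_exp [Fintype k] [DecidableEq k] {A : Matrix n n ℝ}
    {B : Matrix k k ℝ} {S : Matrix n k ℝ} (h : A * S = S * B) : exp A * S = S * exp B := by
  have hpow (r : ℕ) : A ^ r * S = S * B ^ r := by
    induction r with
    | zero => simp
    | succ r ih => rw [pow_succ', Matrix.mul_assoc, ih, ← Matrix.mul_assoc, h, Matrix.mul_assoc,
        ← pow_succ']
  have hleft := (hasSum_matrix_exp A).map (Matrix.addMonoidHomMulRight S)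
    (continuous_id.matrix_mul continuous_const)
  have hright := (hasSum_matrix_exp B).map (Matrix.addMonoidHomMulLeft S)
    (continuous_const.matrix_mul continuous_id)
  refine hleft.unique (hright.congr_fun fun r => ?_)
  simp [Matrix.addMonoidHomMulLeft, Matrix.addMonoidHomMulRight, hpow]

/- The exponential is read off from two intertwining relations `G * S = S * H`: the coordinate
inclusion of the first block has `H = A`, and the kernel vectors `(-A⁻¹ B, 1)` have `H = 0`. -/
theorem matrix_exp_smul_fromBlocks [Fintype k] [DecidableEq k] {A : Matrix n n ℝ}
    (hA : IsUnit A.det) (B : Matrix n k ℝ) (t : ℝ) :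
    exp (t • Matrix.fromBlocks A B 0 (0 : Matrix k k ℝ)) =
      Matrix.fromBlocks (exp (t • A)) (-A⁻¹ * B - exp (t • A) * (-A⁻¹ * B)) 0
        (1 : Matrix k k ℝ) := by
  set G := Matrix.fromBlocks A B 0 (0 : Matrix k k ℝ)
  have hincl := matrix_exp_mul_eq_mul_exp (A := t • G) (B := t • A)
    (S := Matrix.fromRows (1 : Matrix n n ℝ) (0 : Matrix k n ℝ))
    (by simp [G, Matrix.fromBlocks_mul_fromRows, Matrix.fromRows_mul])
  have hker := matrix_exp_mul_eq_mul_exp (A := t • G) (B := 0)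
    (S := Matrix.fromRows (-A⁻¹ * B) (1 : Matrix k k ℝ))
    (by simp [G, Matrix.fromBlocks_mul_fromRows, Matrix.mul_nonsing_inv_cancel_left _ _ hA])
  set E := exp (t • G)
  rw [← E.fromBlocks_toBlocks, Matrix.fromBlocks_mul_fromRows] at hincl hker
  simp only [Matrix.mul_one, Matrix.mul_zero, add_zero, Matrix.fromRows_mul, Matrix.one_mul,
    Matrix.zero_mul, Matrix.fromRows_ext_iff, NormedSpace.exp_zero] at hincl hker
  obtain ⟨h₁₁, h₂₁⟩ := hincl
  obtain ⟨h₁₂, h₂₂⟩ := hker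
  rw [h₁₁] at h₁₂
  rw [h₂₁, Matrix.zero_mul, zero_add] at h₂₂
  rw [← E.fromBlocks_toBlocks, h₁₁, h₂₁, h₂₂, eq_sub_of_add_eq' h₁₂]

theorem matrix_exp_apply_nonneg {A : Matrix n n ℝ} (h : ∀ i j, 0 ≤ A i j) (i j : n) :
    0 ≤ exp A i j :=
  ((hasSum_matrix_exp A).map (Matrix.entryLinearMap ℝ ℝ i j)
    (continuous_id.matrix_elem i j)).nonneg
    fun r => mul_nonneg (by positivity) (Matrix.pow_apply_nonneg h r i j)

theorem matrix_exp_add_smul_one (A : Matrix n n ℝ) (c : ℝ) :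
    exp (A + c • 1) = Real.exp c • exp A := by
  have hscalar : exp (c • (1 : Matrix n n ℝ)) = Real.exp c • 1 := by
    rw [Matrix.smul_one_eq_diagonal, Matrix.exp_diagonal, Matrix.smul_one_eq_diagonal]
    simp [Pi.exp_def, Real.exp_eq_exp_ℝ]
  rw [Matrix.exp_add_of_commute _ _ ((Commute.one_right A).smul_right c), hscalar,
    Matrix.mul_smul, Matrix.mul_one]

theorem matrix_exp_apply_nonneg_of_offDiag_nonneg {A : Matrix n n ℝ}
    (h : ∀ i j, i ≠ j → 0 ≤ A i j) (i j : n) : 0 ≤ exp A i j := by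
  set c : ℝ := ∑ l, |A l l|
  have hshift (a b : n) : 0 ≤ (A + c • (1 : Matrix n n ℝ)) a b := by
    rcases eq_or_ne a b with rfl | hab
    · have hdiag : |A a a| ≤ c :=
        Finset.single_le_sum (f := fun l => |A l l|) (fun _ _ => abs_nonneg _) (Finset.mem_univ a)
      simpa using neg_le_iff_add_nonneg.1 ((neg_le_neg hdiag).trans (neg_abs_le _))
    · simpa [Matrix.one_apply_ne hab] using h a b hab
  have hexp := matrix_exp_apply_nonneg hshift i j
  rw [matrix_exp_add_smul_one, Matrix.smul_apply, smul_eq_mul] at hexp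
  exact (mul_nonneg_iff_of_pos_left (Real.exp_pos c)).1 hexp

end MatrixExponential

theorem mulVec_apply_eq_sum_sub {n : Type*} [Fintype n] (M : Matrix n n ℝ) (v : n → ℝ)
    (i : n) :
    (M *ᵥ v) i = ∑ j, M i j * (v j - v i) + (M *ᵥ 1) i * v i := by
  simp only [Matrix.mulVec, dotProduct, mul_sub, Finset.sum_sub_distrib, Finset.sum_mul,
    Pi.one_apply, mul_one, sub_add_cancel]

/-- The rates among the transient states of a killed Markov chain: `-(M *ᵥ 1) i` is the rate at
which the chain is killed in `i`, and from every state some state with a positive killing rate is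
reached along transitions of positive rate. -/
structure IsTransientRates {n : Type*} [Fintype n] (M : Matrix n n ℝ) : Prop where
  offDiag_nonneg : ∀ i j, i ≠ j → 0 ≤ M i j
  mulVec_one_nonpos : ∀ i, (M *ᵥ 1) i ≤ 0
  killed : ∀ i, ∃ k, Relation.ReflTransGen (fun a b => 0 < M a b) i k ∧ (M *ᵥ 1) k < 0

namespace IsTransientRates

variable {n k : Type*} [Fintype n] {M : Matrix n n ℝ}

/- A negative minimum of `v` propagates along transitions of positive rate, until it reaches a state
where the killing term makes `M *ᵥ v` positive. -/
theorem nonneg_of_mulVec_nonpos (hM : IsTransientRates M) {v : n → ℝ} (hv : M *ᵥ v ≤ 0) :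
    0 ≤ v := by
  by_contra! hneg
  obtain ⟨i, hi⟩ : ∃ i, v i < 0 := by simpa [Pi.le_def] using hneg
  have : Nonempty n := ⟨i⟩
  obtain ⟨i₀, hmin⟩ := Finite.exists_min v
  have hi₀ : v i₀ < 0 := (hmin i).trans_lt hi
  have hflux {a : n} (ha : v a = v i₀) (j : n) : 0 ≤ M a j * (v j - v a) := by
    rcases eq_or_ne a j with rfl | haj
    · simp
    · exact mul_nonneg (hM.offDiag_nonneg a j haj) (sub_nonneg.2 (ha ▸ hmin j))
  have hzero {a : n} (ha : v a = v i₀) :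
      ∑ j, M a j * (v j - v a) = 0 ∧ (M *ᵥ 1) a * v a = 0 := by
    have hsum := Finset.sum_nonneg fun j (_ : j ∈ Finset.univ) => hflux ha j
    have hkill := mul_nonneg_of_nonpos_of_nonpos (hM.mulVec_one_nonpos a) (ha ▸ hi₀.le)
    have hle : (M *ᵥ v) a ≤ 0 := hv a
    rw [mulVec_apply_eq_sum_sub] at hle
    constructor <;> linarith
  obtain ⟨k, hpath, hk⟩ := hM.killed i₀
  have hkmin : v k = v i₀ := by
    clear hk
    induction hpath with
    | refl => rfl
    | @tail a b _ hab ha =>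
      have hterm := (Finset.sum_eq_zero_iff_of_nonneg fun j _ => hflux ha j).1 (hzero ha).1 b
        (Finset.mem_univ b)
      rw [← ha, sub_eq_zero.1 ((mul_eq_zero.1 hterm).resolve_left hab.ne')]
  exact (mul_pos_of_neg_of_neg hk (hkmin ▸ hi₀)).ne' (hzero hkmin).2

variable [DecidableEq n]

theorem isUnit_det (hM : IsTransientRates M) : IsUnit M.det := by
  rw [← Matrix.isUnit_iff_isUnit_det, ← Matrix.mulVec_injective_iff_isUnit]
  refine (injective_iff_map_eq_zero M.mulVecLin).2 fun v hv => ?_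
  have hv : M *ᵥ v = 0 := hv
  exact le_antisymm
    (neg_nonneg.1 (hM.nonneg_of_mulVec_nonpos (by rw [Matrix.mulVec_neg, hv, neg_zero])))
    (hM.nonneg_of_mulVec_nonpos hv.le)

theorem mul_neg_inv (hM : IsTransientRates M) : M * -M⁻¹ = -1 := by
  rw [Matrix.mul_neg, Matrix.mul_nonsing_inv _ hM.isUnit_det]

theorem neg_inv_apply_nonneg (hM : IsTransientRates M) (i j : n) : 0 ≤ (-M⁻¹) i j := by
  have hcol : M *ᵥ (-M⁻¹).col j ≤ 0 := fun a => by
    change (M * -M⁻¹) a j ≤ 0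
    rw [hM.mul_neg_inv, Matrix.neg_apply, neg_nonpos, Matrix.one_apply]
    split_ifs <;> simp
  exact hM.nonneg_of_mulVec_nonpos hcol i

theorem exp_smul_apply_nonneg (hM : IsTransientRates M) {t : ℝ} (ht : 0 ≤ t) (i j : n) :
    0 ≤ exp (t • M) i j :=
  matrix_exp_apply_nonneg_of_offDiag_nonneg
    (fun a b hab => mul_nonneg ht (hM.offDiag_nonneg a b hab)) i j

theorem hasDerivAt_exp_smul_mul_inv_mul (hM : IsTransientRates M) (R : Matrix n k ℝ) (t : ℝ)
    (i : n) (u : k) :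
    HasDerivAt (fun s : ℝ => (exp (s • M) * (M⁻¹ * R)) i u) ((exp (t • M) * R) i u) t := by
  simpa only [Matrix.mul_nonsing_inv_cancel_left _ _ hM.isUnit_det] using
    hasDerivAt_matrix_exp_smul_mul M (M⁻¹ * R) t i u

/- The primitive `exp (t • M) * M⁻¹` of `exp (t • M)` increases from `M⁻¹` and stays nonpositive. -/
theorem integrableOn_exp_smul (hM : IsTransientRates M) (i j : n) :
    IntegrableOn (fun t : ℝ => exp (t • M) i j) (Set.Ioi 0) := by
  have hcont : Continuous fun t : ℝ => exp (t • M) i j :=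
    continuous_iff_continuousAt.2 fun t => (hasDerivAt_matrix_exp_smul M t i j).continuousAt
  have hderiv (t : ℝ) :
      HasDerivAt (fun s : ℝ => (exp (s • M) * M⁻¹) i j) (exp (t • M) i j) t := by
    simpa only [Matrix.mul_one] using hM.hasDerivAt_exp_smul_mul_inv_mul 1 t i j
  refine integrableOn_Ioi_of_intervalIntegral_norm_bounded ((-M⁻¹) i j) 0
    (fun _ => hcont.integrableOn_Ioc) tendsto_id ?_
  filter_upwards [eventually_ge_atTop (0 : ℝ)] with t ht
  have hprimitive_nonpos : (exp (t • M) * M⁻¹) i j ≤ 0 := by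
    rw [Matrix.mul_apply]
    exact Finset.sum_nonpos fun l _ => mul_nonpos_of_nonneg_of_nonpos
      (hM.exp_smul_apply_nonneg ht i l) (neg_nonneg.1 (hM.neg_inv_apply_nonneg l j))
  calc ∫ s in (0)..t, ‖exp (s • M) i j‖
      = ∫ s in (0)..t, exp (s • M) i j :=
        intervalIntegral.integral_congr fun s hs => Real.norm_of_nonneg <|
          hM.exp_smul_apply_nonneg (Set.uIcc_of_le ht ▸ hs).1 i j
    _ = (exp (t • M) * M⁻¹) i j - M⁻¹ i j := by
        rw [intervalIntegral.integral_eq_sub_of_hasDerivAt (fun s _ => hderiv s)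
          (hcont.intervalIntegrable 0 t)]
        simp
    _ ≤ (-M⁻¹) i j := by rw [Matrix.neg_apply]; linarith

theorem integrableOn_exp_smul_mul (hM : IsTransientRates M) (R : Matrix n k ℝ) (i : n) (u : k) :
    IntegrableOn (fun t : ℝ => (exp (t • M) * R) i u) (Set.Ioi 0) := by
  simp only [Matrix.mul_apply]
  exact integrable_finsetSum _ fun j _ => (hM.integrableOn_exp_smul i j).mul_const (R j u)

theorem tendsto_exp_smul_mul (hM : IsTransientRates M) (R : Matrix n k ℝ) (i : n) (u : k) :
    Tendsto (fun t : ℝ => (exp (t • M) * R) i u) atTop (𝓝 0) :=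
  tendsto_zero_of_hasDerivAt_of_integrableOn_Ioi
    (fun t _ => hasDerivAt_matrix_exp_smul_mul M R t i u)
    (hM.integrableOn_exp_smul_mul (M * R) i u) (hM.integrableOn_exp_smul_mul R i u)

theorem integral_exp_smul_mul (hM : IsTransientRates M) (R : Matrix n k ℝ) (i : n) (u : k) :
    ∫ t in Set.Ioi (0 : ℝ), (exp (t • M) * R) i u = (-M⁻¹ * R) i u := by
  rw [integral_Ioi_of_hasDerivAt_of_tendsto'
    (fun t _ => hM.hasDerivAt_exp_smul_mul_inv_mul R t i u) (hM.integrableOn_exp_smul_mul R i u)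
    (hM.tendsto_exp_smul_mul (M⁻¹ * R) i u)]
  simp

end IsTransientRates

section Paths

variable {T E : Type*} [TopologicalSpace T] {x : T → E}

theorem exists_mem_apply_eq_of_dense [LinearOrder T] [OrderTopology T] [DenselyOrdered T]
    [NoMaxOrder T] {t : T} (hx : ∀ᶠ s in 𝓝[>] t, x s = x t) {C V : Set T} (hC : Dense C)
    (hV : V ∈ 𝓝[>] t) : ∃ q ∈ C, q ∈ V ∧ x q = x t := by
  obtain ⟨v, htv, hsub⟩ := mem_nhdsGT_iff_exists_Ioo_subset.1 (inter_mem hV hx)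
  obtain ⟨q, hqC, hq⟩ := hC.exists_between htv
  exact ⟨q, hqC, hsub hq⟩

theorem apply_sInf_eq_of_eventually_eq [ConditionallyCompleteLinearOrder T] [OrderTopology T]
    {y : E} (hbdd : BddBelow {t | x t = y}) (hne : {t | x t = y}.Nonempty)
    (hx : ∀ᶠ s in 𝓝[>] sInf {t | x t = y}, x s = x (sInf {t | x t = y})) :
    x (sInf {t | x t = y}) = y := by
  by_contra hnot
  have hlt {t : T} (ht : x t = y) : sInf {t | x t = y} < t :=
    (csInf_le hbdd ht).lt_of_ne fun h => hnot (h ▸ ht)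
  obtain ⟨t₀, ht₀⟩ := hne
  obtain ⟨v, hv, hsub⟩ := (mem_nhdsGT_iff_exists_Ioo_subset' (hlt ht₀)).1 hx
  obtain ⟨t, ht, htv⟩ := (csInf_lt_iff hbdd ⟨t₀, ht₀⟩).1 hv
  exact hnot ((hsub ⟨hlt ht, htv⟩).symm.trans ht)

end Paths

theorem integrable_of_integrableOn_measureReal_lt {Ω : Type*} [MeasurableSpace Ω] {ν : Measure Ω}
    [IsFiniteMeasure ν] {f : Ω → ℝ} (hf : 0 ≤ᵐ[ν] f) (hfm : AEMeasurable f ν)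
    (hint : IntegrableOn (fun t => ν.real {ω | t < f ω}) (Set.Ioi 0)) : Integrable f ν := by
  refine ⟨hfm.aestronglyMeasurable, (hasFiniteIntegral_iff_ofReal hf).2 ?_⟩
  rw [lintegral_eq_lintegral_meas_lt ν hf hfm]
  simpa only [ofReal_measureReal (measure_ne_top ν _)] using Integrable.lintegral_lt_top hint

theorem cond_measureReal_apply {Ω : Type*} [MeasurableSpace Ω] {s : Set Ω} (hs : MeasurableSet s)
    (μ : Measure Ω) (t : Set Ω) : (μ[|s]).real t = (μ.real s)⁻¹ * μ.real (s ∩ t) := by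
  simp only [Measure.real, cond_apply hs, ENNReal.toReal_mul, ENNReal.toReal_inv]

section Hitting

variable {E Ω : Type*}

/-- The event that the process `X` ever visits the state `y`. -/
def hittingEvent (X : ℝ≥0 → Ω → E) (y : E) : Set Ω := {ω | ∃ t, X t ω = y}

/-- The first time at which the process `X` is in the state `y`, as an infimum; it is `0` outside
`hittingEvent X y`. -/
noncomputable def hittingTime (X : ℝ≥0 → Ω → E) (y : E) (ω : Ω) : ℝ≥0 := sInf {t | X t ω = y}

end Hitting

namespace IsCTMC

variable {E Ω : Type*} [Fintype E] [DecidableEq E] [MeasurableSpace Ω]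
  {G : Matrix E E ℝ} {P : Measure Ω} {X : ℝ≥0 → Ω → E}

theorem measurableSet_exists_mem (hX : IsCTMC G P X) (y : E) {U : Set ℝ≥0} (hU : IsOpen U) :
    MeasurableSet {ω | ∃ t ∈ U, X t ω = y} := by
  obtain ⟨C, hCc, hC⟩ := TopologicalSpace.exists_countable_dense ℝ≥0
  have hcountable : {ω | ∃ t ∈ U, X t ω = y} = ⋃ q ∈ C ∩ U, {ω | X q ω = y} := by
    ext ω
    simp only [Set.mem_ofPred_eq, Set.mem_iUnion, exists_prop]
    constructor
    · rintro ⟨t, htU, ht⟩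
      obtain ⟨q, hqC, hqU, hqt⟩ := exists_mem_apply_eq_of_dense (hX.rightContinuous ω t) hC
        (mem_nhdsWithin_of_mem_nhds (hU.mem_nhds htU))
      exact ⟨q, ⟨hqC, hqU⟩, hqt.trans ht⟩
    · rintro ⟨q, ⟨_, hqU⟩, hq⟩
      exact ⟨q, hqU, hq⟩
  rw [hcountable]
  exact .biUnion (hCc.mono Set.inter_subset_left) fun q _ => hX.measurable q y

theorem measurableSet_hittingEvent (hX : IsCTMC G P X) (y : E) :
    MeasurableSet (hittingEvent X y) := by
  simpa only [hittingEvent, Set.mem_univ, true_and] using hX.measurableSet_exists_mem y isOpen_univ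

theorem measurable_hittingTime (hX : IsCTMC G P X) (y : E) : Measurable (hittingTime X y) := by
  refine measurable_of_Iio fun c => ?_
  have hlt : hittingTime X y ⁻¹' Set.Iio c =
      {ω | ∃ t ∈ Set.Iio c, X t ω = y} ∪ ((hittingEvent X y)ᶜ ∩ {_ω | 0 < c}) := by
    ext ω
    by_cases hω : ω ∈ hittingEvent X y
    · have hiff : hittingTime X y ω < c ↔ ∃ t, X t ω = y ∧ t < c :=
        csInf_lt_iff (OrderBot.bddBelow _) hω
      simp [hω, hiff, and_comm]
    · have hnever (t : ℝ≥0) : X t ω ≠ y := fun ht => hω ⟨t, ht⟩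
      simp [hω, hittingTime, hnever]
  rw [hlt]
  exact (hX.measurableSet_exists_mem y isOpen_Iio).union
    ((hX.measurableSet_hittingEvent y).compl.inter (.const _))

theorem apply_hittingTime (hX : IsCTMC G P X) {y : E} {ω : Ω} (hω : ω ∈ hittingEvent X y) :
    X (hittingTime X y ω) ω = y :=
  apply_sInf_eq_of_eventually_eq (x := (X · ω)) (OrderBot.bddBelow _) hω (hX.rightContinuous ω _)

theorem measureReal_inter (hX : IsCTMC G P X) {s t : ℝ≥0} (hst : s ≤ t) (x y : E) :
    P.real ({ω | X s ω = x} ∩ {ω | X t ω = y}) =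
      P.real {ω | X s ω = x} * exp (((t : ℝ) - s) • G) x y := by
  have hmono : Monotone ![s, t] := by
    intro a b hab
    fin_cases a <;> fin_cases b <;> simp_all
  simpa [Fin.forall_fin_two, Set.ofPred_and] using hX.markov 1 ![s, t] ![x, y] hmono

variable [IsFiniteMeasure P] {x y : E} {p : ℝ}

theorem ae_eq_of_eq (hX : IsCTMC G P X) (hy : ∀ t : ℝ, 0 ≤ t → exp (t • G) y y = 1)
    {s t : ℝ≥0} (hst : s ≤ t) : ∀ᵐ ω ∂P, X s ω = y → X t ω = y := by
  have hstay := hX.measureReal_inter hst y y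
  rw [hy _ (sub_nonneg.2 (NNReal.coe_le_coe.2 hst)), mul_one] at hstay
  have hsplit := measureReal_inter_add_sdiff (μ := P) (s := {ω | X s ω = y}) (hX.measurable t y)
  rw [hstay, add_eq_left, measureReal_eq_zero_iff] at hsplit
  filter_upwards [measure_eq_zero_iff_ae_notMem.1 hsplit] with ω hω hs
  exact of_not_not fun ht => hω ⟨hs, ht⟩

theorem ae_forall_eq_of_eq (hX : IsCTMC G P X) (hy : ∀ t : ℝ, 0 ≤ t → exp (t • G) y y = 1) :
    ∀ᵐ ω ∂P, ∀ s t : ℝ≥0, s ≤ t → X s ω = y → X t ω = y := by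
  obtain ⟨C, hCc, hC⟩ := TopologicalSpace.exists_countable_dense ℝ≥0
  have hdense : ∀ᵐ ω ∂P, ∀ q ∈ C, ∀ r ∈ C, q ≤ r → X q ω = y → X r ω = y := by
    simp only [ae_ball_iff hCc]
    exact fun q _ r _ => eventually_imp_distrib_left.2 (hX.ae_eq_of_eq hy)
  filter_upwards [hdense] with ω hω s t hst hs
  rcases hst.eq_or_lt with rfl | hlt
  · exact hs
  · obtain ⟨q, hqC, hqt, hqs⟩ := exists_mem_apply_eq_of_dense (hX.rightContinuous ω s) hC
      (Ioo_mem_nhdsGT hlt)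
    obtain ⟨r, hrC, htr, hrt⟩ := exists_mem_apply_eq_of_dense (hX.rightContinuous ω t) hC
      self_mem_nhdsWithin
    exact hrt ▸ hω q hqC r hrC (hqt.2.trans htr).le (hqs.trans hs)

theorem ae_eq_iff_hittingTime_le (hX : IsCTMC G P X)
    (hy : ∀ t : ℝ, 0 ≤ t → exp (t • G) y y = 1) :
    ∀ᵐ ω ∂P, ∀ t, X t ω = y ↔ ω ∈ hittingEvent X y ∧ hittingTime X y ω ≤ t := by
  filter_upwards [hX.ae_forall_eq_of_eq hy] with ω hω t
  exact ⟨fun ht => ⟨⟨t, ht⟩, csInf_le (OrderBot.bddBelow _) ht⟩,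
    fun ⟨hhit, hle⟩ => hω _ t hle (hX.apply_hittingTime hhit)⟩

theorem measureReal_inter_hittingTime_le (hX : IsCTMC G P X)
    (hy : ∀ t : ℝ, 0 ≤ t → exp (t • G) y y = 1) (x : E) (t : ℝ≥0) :
    P.real ({ω | X 0 ω = x} ∩ hittingEvent X y ∩ {ω | hittingTime X y ω ≤ t}) =
      P.real {ω | X 0 ω = x} * exp ((t : ℝ) • G) x y := by
  have hmarkov := hX.measureReal_inter (zero_le (a := t)) x y
  rw [NNReal.coe_zero, sub_zero] at hmarkov
  rw [← hmarkov, Set.inter_assoc]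
  refine measureReal_congr ?_
  filter_upwards [hX.ae_eq_iff_hittingTime_le hy] with ω hω
  exact propext (and_congr_right' (hω t).symm)

theorem measureReal_inter_hittingEvent (hX : IsCTMC G P X)
    (hy : ∀ t : ℝ, 0 ≤ t → exp (t • G) y y = 1)
    (hp : Tendsto (fun t : ℝ => exp (t • G) x y) atTop (𝓝 p)) :
    P.real ({ω | X 0 ω = x} ∩ hittingEvent X y) = P.real {ω | X 0 ω = x} * p := by
  set B := {ω | X 0 ω = x} ∩ hittingEvent X y
  have hmono : Monotone fun t : ℝ≥0 => B ∩ {ω | hittingTime X y ω ≤ t} := fun s t hst =>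
    Set.inter_subset_inter_right _ fun ω (hω : hittingTime X y ω ≤ s) => hω.trans hst
  have hunion : ⋃ t : ℝ≥0, B ∩ {ω | hittingTime X y ω ≤ t} = B := by
    rw [← Set.inter_iUnion, Set.inter_eq_left]
    exact fun ω _ => Set.mem_iUnion.2 ⟨hittingTime X y ω, le_refl (hittingTime X y ω)⟩
  have hlim := (ENNReal.tendsto_toReal (measure_ne_top P _)).comp
    (tendsto_measure_iUnion_atTop (μ := P) hmono)
  rw [hunion] at hlim
  exact tendsto_nhds_unique hlim <|
    ((hp.comp (NNReal.tendsto_coe_atTop.2 tendsto_id)).const_mul _).congr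
      fun t => (hX.measureReal_inter_hittingTime_le hy x t).symm

theorem measureReal_inter_lt_hittingTime (hX : IsCTMC G P X)
    (hy : ∀ t : ℝ, 0 ≤ t → exp (t • G) y y = 1)
    (hp : Tendsto (fun t : ℝ => exp (t • G) x y) atTop (𝓝 p)) (t : ℝ≥0) :
    P.real ({ω | X 0 ω = x} ∩ hittingEvent X y ∩ {ω | t < hittingTime X y ω}) =
      P.real {ω | X 0 ω = x} * (p - exp ((t : ℝ) • G) x y) := by
  have hsplit := measureReal_inter_add_sdiff (μ := P)
    (s := {ω | X 0 ω = x} ∩ hittingEvent X y)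
    (measurableSet_le (hX.measurable_hittingTime y) (measurable_const (a := t)))
  rw [hX.measureReal_inter_hittingTime_le hy, hX.measureReal_inter_hittingEvent hy hp,
    Set.sdiff_eq, Set.compl_ofPred] at hsplit
  simp only [not_le] at hsplit
  rw [mul_sub, eq_sub_iff_add_eq', hsplit]

theorem cond_measureReal_hittingEvent (hX : IsCTMC G P X)
    (hy : ∀ t : ℝ, 0 ≤ t → exp (t • G) y y = 1)
    (hp : Tendsto (fun t : ℝ => exp (t • G) x y) atTop (𝓝 p)) (hx : P {ω | X 0 ω = x} ≠ 0) :
    (P[|{ω | X 0 ω = x}]).real (hittingEvent X y) = p := by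
  rw [cond_measureReal_apply (hX.measurable 0 x), hX.measureReal_inter_hittingEvent hy hp,
    inv_mul_cancel_left₀ (by simpa [measureReal_eq_zero_iff] using hx)]

theorem cond_measureReal_lt_hittingTime (hX : IsCTMC G P X)
    (hy : ∀ t : ℝ, 0 ≤ t → exp (t • G) y y = 1)
    (hp : Tendsto (fun t : ℝ => exp (t • G) x y) atTop (𝓝 p)) (hx : P {ω | X 0 ω = x} ≠ 0)
    (t : ℝ≥0) :
    (P[|{ω | X 0 ω = x} ∩ hittingEvent X y]).real {ω | t < hittingTime X y ω} =
      (p - exp ((t : ℝ) • G) x y) / p := by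
  have hx' : P.real {ω | X 0 ω = x} ≠ 0 := by simpa [measureReal_eq_zero_iff] using hx
  rw [cond_measureReal_apply ((hX.measurable 0 x).inter (hX.measurableSet_hittingEvent y)),
    hX.measureReal_inter_lt_hittingTime hy hp, hX.measureReal_inter_hittingEvent hy hp,
    ← div_eq_inv_mul, mul_div_mul_left _ _ hx']

theorem integrable_hittingTime (hX : IsCTMC G P X)
    (hy : ∀ t : ℝ, 0 ≤ t → exp (t • G) y y = 1)
    (hp : Tendsto (fun t : ℝ => exp (t • G) x y) atTop (𝓝 p)) (hx : P {ω | X 0 ω = x} ≠ 0)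
    (hint : IntegrableOn (fun t : ℝ => p - exp (t • G) x y) (Set.Ioi 0)) :
    Integrable (fun ω => (hittingTime X y ω : ℝ)) (P[|{ω | X 0 ω = x} ∩ hittingEvent X y]) := by
  refine integrable_of_integrableOn_measureReal_lt (.of_forall fun ω => NNReal.coe_nonneg _)
    (hX.measurable_hittingTime y).coe_nnreal_real.aemeasurable ?_
  refine IntegrableOn.congr_fun (hint.div_const p) (fun t ht => ?_) measurableSet_Ioi
  lift t to ℝ≥0 using (Set.mem_Ioi.1 ht).le
  simp only [NNReal.coe_lt_coe, hX.cond_measureReal_lt_hittingTime hy hp hx]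

theorem integral_hittingTime (hX : IsCTMC G P X)
    (hy : ∀ t : ℝ, 0 ≤ t → exp (t • G) y y = 1)
    (hp : Tendsto (fun t : ℝ => exp (t • G) x y) atTop (𝓝 p)) (hx : P {ω | X 0 ω = x} ≠ 0)
    (hint : IntegrableOn (fun t : ℝ => p - exp (t • G) x y) (Set.Ioi 0)) :
    ∫ ω, (hittingTime X y ω : ℝ) ∂P[|{ω | X 0 ω = x} ∩ hittingEvent X y] =
      (∫ t in Set.Ioi (0 : ℝ), (p - exp (t • G) x y)) / p := by
  rw [(hX.integrable_hittingTime hy hp hx hint).integral_eq_integral_meas_lt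
    (.of_forall fun ω => NNReal.coe_nonneg _), ← integral_div]
  refine setIntegral_congr_fun measurableSet_Ioi fun t ht => ?_
  lift t to ℝ≥0 using (Set.mem_Ioi.1 ht).le
  simp only [NNReal.coe_lt_coe, hX.cond_measureReal_lt_hittingTime hy hp hx]

end IsCTMC

section AbsorbingChains

theorem exp_smul_fromBlocks_inl_inr {n k : Type*} [Fintype n] [DecidableEq n] [Fintype k]
    [DecidableEq k] {M : Matrix n n ℝ} (hM : IsUnit M.det) (Q : Matrix n k ℝ) (t : ℝ) (i : n)
    (u : k) :
    exp (t • Matrix.fromBlocks M Q 0 (0 : Matrix k k ℝ)) (.inl i) (.inr u) =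
      (-M⁻¹ * Q) i u - (exp (t • M) * (-M⁻¹ * Q)) i u := by
  rw [matrix_exp_smul_fromBlocks hM]
  rfl

theorem proposition3_general {n k : Type*} [Fintype n] [DecidableEq n] [Fintype k] [DecidableEq k]
    {M : Matrix n n ℝ} (hM : IsTransientRates M) (Q : Matrix n k ℝ) :
    IsUnit M.det ∧
    ∀ (Ω : Type*) [MeasurableSpace Ω] (P : Measure Ω) [IsFiniteMeasure P]
      (X : ℝ≥0 → Ω → n ⊕ k), IsCTMC (Matrix.fromBlocks M Q 0 0) P X →
    ∀ (i : n) (u : k), P {ω | X 0 ω = .inl i} ≠ 0 →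
      (P[|{ω | X 0 ω = .inl i}]).real (hittingEvent X (.inr u)) = (-M⁻¹ * Q) i u ∧
      (0 < (P[|{ω | X 0 ω = .inl i}]).real (hittingEvent X (.inr u)) →
        Integrable (fun ω => (hittingTime X (.inr u) ω : ℝ))
          (P[|{ω | X 0 ω = .inl i} ∩ hittingEvent X (.inr u)]) ∧
        ∫ ω, (hittingTime X (.inr u) ω : ℝ) ∂P[|{ω | X 0 ω = .inl i} ∩ hittingEvent X (.inr u)] =
          ((-M⁻¹) ^ 2 * Q : Matrix n k ℝ) i u / (-M⁻¹ * Q) i u) := by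
  refine ⟨hM.isUnit_det, fun Ω _ P _ X hX i u hi => ?_⟩
  set G := Matrix.fromBlocks M Q 0 (0 : Matrix k k ℝ)
  have habs (t : ℝ) (_ : 0 ≤ t) : exp (t • G) (.inr u) (.inr u) = 1 := by
    simp [G, matrix_exp_smul_fromBlocks hM.isUnit_det]
  have hexp (t : ℝ) : exp (t • G) (.inl i) (.inr u) =
      (-M⁻¹ * Q) i u - (exp (t • M) * (-M⁻¹ * Q)) i u :=
    exp_smul_fromBlocks_inl_inr hM.isUnit_det Q t i u
  have hlim : Tendsto (fun t : ℝ => exp (t • G) (.inl i) (.inr u)) atTop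
      (𝓝 ((-M⁻¹ * Q) i u)) := by
    simpa only [hexp, sub_zero] using
      tendsto_const_nhds.sub (hM.tendsto_exp_smul_mul (-M⁻¹ * Q) i u)
  have htail : (fun t : ℝ => (-M⁻¹ * Q) i u - exp (t • G) (.inl i) (.inr u)) =
      fun t : ℝ => (exp (t • M) * (-M⁻¹ * Q)) i u := by
    funext t
    rw [hexp, sub_sub_cancel]
  have hint := htail ▸ hM.integrableOn_exp_smul_mul (-M⁻¹ * Q) i u
  refine ⟨hX.cond_measureReal_hittingEvent habs hlim hi, fun _ =>
    ⟨hX.integrable_hittingTime habs hlim hi hint, ?_⟩⟩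
  rw [hX.integral_hittingTime habs hlim hi hint, htail, hM.integral_exp_smul_mul, pow_two,
    Matrix.mul_assoc]

theorem IsAbsorbingRates.mulVec_one_apply {m : ℕ} {M : Matrix (Fin m) (Fin m) ℝ}
    {Q : Matrix (Fin m) (Fin 2) ℝ} (h : IsAbsorbingRates M Q) (i : Fin m) :
    (M *ᵥ 1) i = -∑ u, Q i u := by
  have hrow : (M *ᵥ 1) i = M i i + ∑ j ∈ Finset.univ.erase i, M i j := by
    simp [Matrix.mulVec, dotProduct]
  rw [hrow, h.conservation, Fin.sum_univ_two]
  ring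

theorem IsAbsorbingRates.isTransientRates {m : ℕ} {M : Matrix (Fin m) (Fin m) ℝ}
    {Q : Matrix (Fin m) (Fin 2) ℝ} (h : IsAbsorbingRates M Q) : IsTransientRates M where
  offDiag_nonneg := h.offDiag_nonneg
  mulVec_one_nonpos i := by
    rw [h.mulVec_one_apply]
    exact neg_nonpos.2 (Finset.sum_nonneg fun u _ => h.absorb_nonneg i u)
  killed i := by
    obtain ⟨k, hpath, u, hu⟩ := h.absorbing i
    refine ⟨k, hpath, ?_⟩
    rw [h.mulVec_one_apply]
    exact neg_neg_of_pos
      (Finset.sum_pos' (fun u _ => h.absorb_nonneg k u) ⟨u, Finset.mem_univ u, hu⟩)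

theorem isAbsorbingRates_transientMatrix {m : ℕ} {r : Fin m → Fin m → ℝ}
    {Q : Matrix (Fin m) (Fin 2) ℝ} (hr : ∀ i j, i ≠ j → 0 ≤ r i j) (hQ : ∀ i u, 0 ≤ Q i u)
    (hreach : ∀ i, ∃ k, Relation.ReflTransGen (fun a b => a ≠ b ∧ 0 < r a b) i k ∧
      ∃ u, 0 < Q k u) :
    IsAbsorbingRates (transientMatrix r Q) Q := by
  have hoff {i j : Fin m} (hij : i ≠ j) : transientMatrix r Q i j = r i j := if_neg hij
  refine ⟨fun i j hij => (hoff hij).symm ▸ hr i j hij, hQ, fun i => ?_, fun i => ?_⟩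
  · rw [Finset.sum_congr rfl fun j hj => hoff (Finset.ne_of_mem_erase hj).symm]
    exact if_pos rfl
  · obtain ⟨k, hpath, hk⟩ := hreach i
    exact ⟨k, Relation.ReflTransGen.mono (fun a b ⟨hab, hpos⟩ => (hoff hab).symm ▸ hpos) i k hpath,
      hk⟩

end AbsorbingChains

namespace RiderParams

variable {U : ℕ} (c : RiderParams U)

theorem acceptRate_nonneg : 0 ≤ c.μ * c.p := mul_nonneg c.μ_nonneg c.p_nonneg

theorem dropRate_nonneg : 0 ≤ c.μ * (1 - c.p) + c.ηN :=
  add_nonneg (mul_nonneg c.μ_nonneg (sub_nonneg.2 c.p_le_one)) c.ηN_nonneg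

theorem notifyRate_nonneg (ℓ k : ℕ) : 0 ≤ c.notifyRate ℓ k := by
  unfold notifyRate
  split_ifs
  · exact c.q_nonneg k
  · exact mul_nonneg (Nat.cast_nonneg _) c.dropRate_nonneg
  · exact le_rfl

theorem baRate_nonneg (s s' : RiderState) : 0 ≤ c.baRate s s' := by
  have haccept (h : Prop) [Decidable h] : 0 ≤ if h then c.μ * c.p else 0 :=
    ite_nonneg c.acceptRate_nonneg le_rfl
  cases s <;> cases s'
  · exact c.notifyRate_nonneg _ _
  · exact haccept _
  · exact le_rfl
  · exact add_nonneg (haccept _)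
      (ite_nonneg (mul_nonneg (Nat.cast_nonneg _) c.dropRate_nonneg) le_rfl)

theorem baMatchRate_nonneg (s : RiderState) : 0 ≤ c.baMatchRate s := by
  cases s
  · exact ite_nonneg le_rfl c.acceptRate_nonneg
  · exact ite_nonneg (add_nonneg c.μ_nonneg c.ηN_nonneg) c.acceptRate_nonneg

variable {c}

theorem baMatchRate_baState_pos (hμ : 0 < c.μ) (hp : 0 < c.p) {i : Fin (2 * U)}
    (hi : (i : ℕ) ≠ 0) : 0 < c.baMatchRate (baState U i) := by
  unfold baState
  split_ifs
  · exact (mul_pos hμ hp).trans_eq (if_neg hi).symm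
  · simp only [baMatchRate]
    split_ifs
    · exact add_pos_of_pos_of_nonneg hμ c.ηN_nonneg
    · exact mul_pos hμ hp

/- Without reneging, a rider can be matched at once in every state but `R_0`, and `R_0` leads to
some `R_ℓ` with `1 ≤ ℓ`. -/
theorem CanLeave.isAbsorbingRates (hc : c.CanLeave) {m : ℕ} (hm : ∀ ℓ, 1 ≤ ℓ → ℓ ≤ U → ℓ < m)
    {r : Fin m → Fin m → ℝ} {Q : Matrix (Fin m) (Fin 2) ℝ} (hr : ∀ i j, 0 ≤ r i j)
    (hQ : ∀ i u, 0 ≤ Q i u) (hrenege : ∀ i, Q i 0 = c.η)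
    (hnotify : ∀ i k : Fin m, (i : ℕ) = 0 → (k : ℕ) ≤ U → r i k = c.q k)
    (hmatch : 0 < c.μ → 0 < c.p → ∀ i : Fin m, (i : ℕ) ≠ 0 → 0 < Q i 1) :
    IsAbsorbingRates (transientMatrix r Q) Q := by
  refine isAbsorbingRates_transientMatrix (fun i j _ => hr i j) hQ fun i => ?_
  rcases hc with hη | ⟨hμ, hp, ℓ, hℓ, hℓU, hq⟩
  · exact ⟨i, .refl, 0, (hrenege i).symm ▸ hη⟩
  · by_cases hi : (i : ℕ) = 0
    · let k : Fin m := ⟨ℓ, hm ℓ hℓ hℓU⟩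
      have hk : (k : ℕ) ≠ 0 := Nat.one_le_iff_ne_zero.1 hℓ
      have hik : i ≠ k := fun h => hk (h ▸ hi)
      exact ⟨k, .single ⟨hik, (hnotify i k hi hℓU).symm ▸ hq⟩, 1, hmatch hμ hp k hk⟩
    · exact ⟨i, .refl, 1, hmatch hμ hp i hi⟩

theorem isAbsorbingRates_faM (hc : c.CanLeave) : IsAbsorbingRates c.faM c.faQ := by
  refine hc.isAbsorbingRates (fun ℓ _ hℓU => Nat.lt_succ_of_le hℓU)
    (fun i j => c.notifyRate_nonneg i j) (fun i u => ?_) (fun i => rfl)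
    (fun i k hi _ => if_pos hi) fun hμ hp i hi => ?_
  · exact ite_nonneg c.η_nonneg
      (mul_nonneg (mul_nonneg (Nat.cast_nonneg _) c.μ_nonneg) c.p_nonneg)
  · exact mul_pos (mul_pos (Nat.cast_pos.2 (Nat.pos_of_ne_zero hi)) hμ) hp

theorem isAbsorbingRates_baM (hc : c.CanLeave) : IsAbsorbingRates c.baM c.baQ := by
  refine hc.isAbsorbingRates (fun ℓ hℓ hℓU => by lia)
    (fun i j => c.baRate_nonneg _ _) (fun i u => ?_) (fun i => rfl) (fun i k hi hk => ?_)
    fun hμ hp i hi => baMatchRate_baState_pos hμ hp hi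
  · exact ite_nonneg c.η_nonneg (c.baMatchRate_nonneg _)
  · have hwaiting : baState U i = .waiting i := if_pos (hi ▸ Nat.zero_le U)
    rw [hwaiting, show baState U k = .waiting k from if_pos hk]
    exact if_pos hi

end RiderParams

theorem proposition3 :
    -- the rider chains under First Accept and Best Accept are absorbing Markov chains
    (∀ (U : ℕ) (c : RiderParams U), 1 ≤ U → c.CanLeave →
      IsAbsorbingRates c.faM c.faQ ∧ IsAbsorbingRates c.baM c.baQ) ∧
    -- match probability and conditional match time in every such chain, `N = -M⁻¹` being the fundamental matrix
    (∀ (m : ℕ) (M : Matrix (Fin m) (Fin m) ℝ) (Q : Matrix (Fin m) (Fin 2) ℝ),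
      IsAbsorbingRates M Q →
      IsUnit M.det ∧
      ∀ (Ω : Type*) [MeasurableSpace Ω] (P : Measure Ω) [IsProbabilityMeasure P]
        (X : ℝ≥0 → Ω → Fin m ⊕ Fin 2), IsCTMC (absorbingGenerator M Q) P X →
      ∀ i : Fin m, P {ω | X 0 ω = Sum.inl i} ≠ 0 →
        (P[|{ω | X 0 ω = Sum.inl i}]).real (matchedEvent X) = (fundamentalMatrix M * Q) i 1 ∧
        (0 < (P[|{ω | X 0 ω = Sum.inl i}]).real (matchedEvent X) →
          Integrable (matchTime X) (P[|{ω | X 0 ω = Sum.inl i} ∩ matchedEvent X]) ∧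
          ∫ ω, matchTime X ω ∂(P[|{ω | X 0 ω = Sum.inl i} ∩ matchedEvent X]) =
            (fundamentalMatrix M ^ 2 * Q : Matrix (Fin m) (Fin 2) ℝ) i 1 /
              (fundamentalMatrix M * Q) i 1)) := by
  refine ⟨fun _ _ _ hc =>
    ⟨RiderParams.isAbsorbingRates_faM hc, RiderParams.isAbsorbingRates_baM hc⟩, fun m M Q h => ?_⟩
  obtain ⟨hdet, hchain⟩ := proposition3_general h.isTransientRates Q
  exact ⟨hdet, fun Ω _ P _ X hX i hi => hchain Ω P X hX i 1 hi⟩
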